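/- Let $X$ be a separable real Banach space. A sequence $\beta=(e_n)_{n\ge 1}$ in $X$ is called fundamental if its closed linear span is $X$; for $n\ge 1$ write $E_n^\beta=\operatorname{span}\{e_1,\dots,e_n\}$. For a bounded set $K\subset X$ define the inner radii $$r_n^\beta=\sup\{r\ge 0 : \text{there is } x\in E_n^\beta \text{ with } \{y\in E_n^\beta:\|y-x\|\le r\}\subset K\}$$ and the heights $$h_n^\beta=\sup\{d(x,E_n^\beta) : x\in K\}.$$ The bounded set $K$ is called small if there exist $\varepsilon\in(0,1)$, a fundamental sequence $\beta$ in $X$ and a strictly increasing $\sigma:\mathbb N\to\mathbb N=\{1,2,\dots\}$ such that for every $n\in\mathbb N$ (with $0<r^\beta_{\sigma(n)}<\infty$) $$0<\frac{h_{\sigma(n)}^\beta}{r_{\sigma(n)}^\beta}\le\frac{1}{2\,\sigma(n)^2\left(\left(1+\frac{2}{\varepsilon}\right)^{\sigma(n)}+2\right)}.$$ The space $X$ has the $\pi$-property if there is a uniformly bounded net of finite rank bounded linear projections on $X$ converging strongly (that is, pointwise in norm) to the identity on $X$. **Theorem.** Let $X$ be a separable real Banach space. If there exist a small compact set $K\subset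 X$ (not necessarily convex) and a Lipschitz retraction from $X$ onto $K$, i.e. a Lipschitz map $R:X\to K$ with $R(x)=x$ for all $x\in K$, then $X$ has the $\pi$-property. -/

import Mathlib

open Filter Topology
open scoped NNReal

noncomputable section

/-- A Banach space `X` has the π-property: there is a uniformly bounded net of finite rank
bounded linear projections on `X` that converges strongly (pointwise) to the identity. -/
def HasPiProperty.{u} (X : Type u) [NormedAddCommGroup X] [NormedSpace ℝ X] : Prop :=
  ∃ (ι : Type u) (_ : Preorder ι) (_ : IsDirected ι (· ≤ ·)) (_ : Nonempty ι)
    (S : ι → X →L[ℝ] X) (C : ℝ),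
    (∀ α, IsIdempotentElem (S α)) ∧
    (∀ α, FiniteDimensional ℝ (LinearMap.range (S α : X →ₗ[ℝ] X))) ∧
    (∀ α, ‖S α‖ ≤ C) ∧
    ∀ x : X, Tendsto (fun α => S α x) atTop (𝓝 x)

/-- `R` is a Lipschitz retraction from the whole space `X` onto the subset `K`. -/
def IsLipschitzRetractionOnto {X : Type*} [PseudoEMetricSpace X] (R : X → X) (K : Set X) : Prop :=
  (∃ L : ℝ≥0, LipschitzWith L R) ∧ (∀ x, R x ∈ K) ∧ ∀ x ∈ K, R x = x

section Small

variable {X : Type*} [NormedAddCommGroup X] [NormedSpace ℝ X]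

/-- A sequence is fundamental if its closed linear span is the whole space. The sequence
`e 0, e 1, …` stands for `e_1, e_2, …`. -/
def IsFundamentalSeq (e : ℕ → X) : Prop :=
  (Submodule.span ℝ (Set.range e)).topologicalClosure = ⊤

/-- `E_n`, the linear span of the first `n` terms `e 0, …, e (n - 1)` of the sequence. -/
def initialSpan (e : ℕ → X) (n : ℕ) : Submodule ℝ X :=
  Submodule.span ℝ (e '' Set.Iio n)

/-- The inner radius `r_n` of `K`: the supremum of the radii of the closed balls of `E_n`
(centered in `E_n`) that are contained in `K ∩ E_n`. -/
def innerRadius (e : ℕ → X) (K : Set X) (n : ℕ) : ℝ :=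
  sSup {r : ℝ | 0 ≤ r ∧ ∃ x ∈ initialSpan e n,
    Metric.closedBall x r ∩ (initialSpan e n : Set X) ⊆ K ∩ (initialSpan e n : Set X)}

/-- The height `h_n` of `K`: the supremum of the distances from points of `K` to `E_n`. -/
def height (e : ℕ → X) (K : Set X) (n : ℕ) : ℝ :=
  sSup ((fun x => Metric.infDist x (initialSpan e n : Set X)) '' K)

/-- Small bounded subsets. The strict inequality `0 < h / r` forces `0 < h` and `0 < r`, also with
the conventions `h / 0 = 0` and `sSup s = 0` for `s` empty or unbounded. -/
def IsSmall (K : Set X) : Prop :=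
  Bornology.IsBounded K ∧
  ∃ ε : ℝ, 0 < ε ∧ ε < 1 ∧
  ∃ e : ℕ → X, IsFundamentalSeq e ∧
  ∃ σ : ℕ → ℕ, StrictMono σ ∧ (∀ n, 1 ≤ σ n) ∧
  ∀ n : ℕ,
    0 < height e K (σ n) / innerRadius e K (σ n) ∧
    height e K (σ n) / innerRadius e K (σ n) ≤
      1 / (2 * (σ n : ℝ) ^ 2 * ((1 + 2 / ε) ^ (σ n) + 2))

end Small

end

/-! Let E = E_n with n a large value of σ. K contains a ball of E of radius r, and R takes values
within h of E, with h tiny compared with r. Average the derivative of a mollified R over a box that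
is long along E and slightly thickened in finitely many directions w_k. The mean is linear and
inherits the Lipschitz bound; by the divergence theorem its values on edges are mean increments of R
between opposite faces (`exists_linear_average`). Along E these are almost the edges themselves;
along w_k they stay close to E. Projecting to E and inverting a perturbation of the identity gives a
linear T fixing E with ‖T w_k‖ ≤ 2(L + 8) (`exists_linear_projection_of_retraction`).

T depends on the w_k. Trace duality with Hahn–Banach (`exists_projection_of_forall_finite`)
exchanges the quantifiers: one projection is bounded along all functionals of a finite family.
Including an ε-net of the dual ball in the family turns this into a norm bound, at the cost of a
factor 1/(1 - ε). The net has at most (1 + 2/ε)^n points, whence the exponential in the smallness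
condition; enlarging ε slightly absorbs polynomial factors and L for large n. -/

/-! ### Averaging a Lipschitz map over a box -/

open MeasureTheory Set in
/-- The averaged derivative of a `C¹` function over a box. -/
theorem exists_average_fderiv {X : Type*} [NormedAddCommGroup X] [NormedSpace ℝ X]
    [CompleteSpace X] {m : ℕ} (G : (Fin (m + 1) → ℝ) → X) (hG : ContDiff ℝ 1 G)
    (l : Fin (m + 1) → ℝ) (hl : ∀ i, 0 < l i) :
    ∃ T : (Fin (m + 1) → ℝ) →ₗ[ℝ] X,
      (∀ c M, (∀ y, ‖fderiv ℝ G y c‖ ≤ M) → ‖T c‖ ≤ M) ∧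
      ∀ (i : Fin (m + 1)) (C : Set X), Convex ℝ C → IsClosed C →
        (∀ y, (∀ j, 0 ≤ y j ∧ y j ≤ l j) → y i = 0 → G (y + Pi.single i (l i)) - G y ∈ C) →
        l i • T (Pi.single i 1) ∈ C := by
  have hD : Continuous (fderiv ℝ G) := hG.continuous_fderiv one_ne_zero
  set Q : Set (Fin (m + 1) → ℝ) := Icc 0 l with hQ
  have hvol : volume.real Q = ∏ i, l i := by
    rw [hQ, Measure.real, Real.volume_Icc_pi_toReal (a := 0) (fun i => (hl i).le)]; simp
  have hpos : 0 < volume.real Q := by rw [hvol]; exact Finset.prod_pos fun i _ => hl i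
  have hint : ∀ c, IntegrableOn (fun y => fderiv ℝ G y c) Q := fun c =>
    ((hD.clm_apply continuous_const).continuousOn).integrableOn_compact isCompact_Icc
  refine ⟨{ toFun := fun c => (volume.real Q)⁻¹ • ∫ y in Q, fderiv ℝ G y c
            map_add' := ?_, map_smul' := ?_ }, ?_, ?_⟩
  · intro c c'
    simp only [map_add]
    rw [integral_add (hint c) (hint c'), smul_add]
  · intro a c
    simp only [map_smul, RingHom.id_apply]
    rw [integral_smul, smul_comm]
  · intro c M hM
    have := norm_setIntegral_le_of_norm_le_const (μ := volume) (s := Q) (C := M)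
      (isCompact_Icc.measure_lt_top) (fun y _ => hM y)
    simp only [LinearMap.coe_mk, AddHom.coe_mk, norm_smul, norm_inv, Real.norm_eq_abs,
      abs_of_pos hpos]
    rw [inv_mul_le_iff₀ hpos, mul_comm]
    exact this
  · intro i C hC hCc hmem
    -- The field with `G` in slot `i` and zero elsewhere has divergence ∂ᵢG.
    have key := integral_divergence_of_hasFDerivAt_off_countable' (0 : Fin (m + 1) → ℝ) l
      (fun i => (hl i).le) (fun j => if j = i then G else 0)
      (fun j y => if j = i then fderiv ℝ G y else 0) ∅ countable_empty
      (fun j => by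
        by_cases h : j = i
        · simpa [h] using hG.continuous.continuousOn
        · simpa [h] using! continuousOn_const (c := (0 : X)))
      (fun y _ j => by
        by_cases h : j = i
        · simpa [h] using (hG.differentiable one_ne_zero y).hasFDerivAt
        · simpa [h] using! hasFDerivAt_const (0 : X) y)
      (by
        have : (fun y => ∑ j, (if j = i then fderiv ℝ G y else 0) (Pi.single j 1))
            = fun y => fderiv ℝ G y (Pi.single i 1) := by
          funext y
          rw [Finset.sum_eq_single i] <;> simp +contextual
        rw [this]; exact hint _)
    have e1 : ∀ y, ∑ j, (if j = i then fderiv ℝ G y else 0) (Pi.single j 1)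
            = fderiv ℝ G y (Pi.single i 1) := fun y => by
      rw [Finset.sum_eq_single i] <;> simp +contextual
    simp only [e1] at key
    rw [Finset.sum_eq_single i (by simp +contextual) (by simp)] at key
    simp only [if_true, Pi.zero_apply] at key
    set F : Set (Fin m → ℝ) := Icc ((0 : Fin (m + 1) → ℝ) ∘ i.succAbove) (l ∘ i.succAbove) with hF
    have hFvol : volume.real F = ∏ j, l (i.succAbove j) := by
      rw [hF, Measure.real, Real.volume_Icc_pi_toReal (a := (0 : Fin (m + 1) → ℝ) ∘ i.succAbove)
      (b := l ∘ i.succAbove) (fun j => (hl _).le)]; simp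
    have hFpos : 0 < volume.real F := by rw [hFvol]; exact Finset.prod_pos fun j _ => hl _
    have hcont : ∀ a : ℝ, Continuous fun x : Fin m → ℝ => G (i.insertNth a x) := fun a =>
      hG.continuous.comp (continuous_const.finInsertNth i continuous_id)
    have hi : ∀ a : ℝ, IntegrableOn (fun x : Fin m → ℝ => G (i.insertNth a x)) F := fun a =>
      (hcont a).continuousOn.integrableOn_compact isCompact_Icc
    rw [← integral_sub (hi _) (hi _)] at key
    -- A closed convex set contains the mean of its points.
    have hmemF : ⨍ x in F, (G (i.insertNth (l i) x) - G (i.insertNth 0 x)) ∈ C := by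
      refine hC.set_average_mem hCc ?_ isCompact_Icc.measure_lt_top.ne ?_ ((hi _).sub (hi _))
      · intro h0
        simp [Measure.real, h0] at hFpos
      · filter_upwards [ae_restrict_mem measurableSet_Icc] with x hx
        have := hmem (i.insertNth 0 x) (by
          intro j
          refine Fin.succAboveCases i ?_ (fun k => ?_) j
          · simp [(hl i).le]
          · simpa using ⟨hx.1 k, hx.2 k⟩) (by simp)
        convert! this using 3
        funext j
        refine Fin.succAboveCases i ?_ (fun k => ?_) j
        · simp
        · simp
    rw [setAverage_eq] at hmemF
    convert! hmemF using 1
    simp only [LinearMap.coe_mk, AddHom.coe_mk]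
    rw [key, smul_smul]
    congr 1
    rw [hvol, hFvol, Fin.prod_univ_succAbove _ i]
    have := (hl i).ne'
    have := (Finset.prod_pos fun j (_ : j ∈ Finset.univ) => hl (i.succAbove j)).ne'
    field_simp

open MeasureTheory in
/-- Smooth approximation of a Lipschitz map along a finite family of directions. -/
theorem exists_contDiff_approx {X : Type*} [NormedAddCommGroup X] [NormedSpace ℝ X]
    [CompleteSpace X] {ι : Type*} [Fintype ι] (R : X → X) (L : ℝ≥0) (hR : LipschitzWith L R)
    (w : ι → X) (p : X) {κ : ℝ} (hκ : 0 < κ) :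
    ∃ G : (ι → ℝ) → X, ContDiff ℝ 1 G ∧ (∀ y, ‖G y - R (p + ∑ i, y i • w i)‖ ≤ κ) ∧
      ∀ y y', ‖G y - G y'‖ ≤ L * ‖∑ i, (y i - y' i) • w i‖ := by
  set g : (ι → ℝ) → X := fun y => R (p + ∑ i, y i • w i) with hg
  have hlin : Continuous fun y : ι → ℝ => p + ∑ i, y i • w i := by fun_prop
  have hgc : Continuous g := hR.continuous.comp hlin
  have hgL : ∀ y y', ‖g y - g y'‖ ≤ L * ‖∑ i, (y i - y' i) • w i‖ := fun y y' => by
    have := hR.norm_sub_le (p + ∑ i, y i • w i) (p + ∑ i, y' i • w i)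
    simpa [hg, sub_smul, Finset.sum_sub_distrib] using this
  set S : ℝ := L * ∑ i, ‖w i‖ with hS
  have hS0 : 0 ≤ S := by positivity
  -- `g` is `S`-Lipschitz for the sup norm, so it varies by at most `κ` on this radius; the `+ 1`
  -- covers `S = 0`.
  let φ : ContDiffBump (0 : ι → ℝ) := ⟨κ / (S + 1) / 2, κ / (S + 1), by positivity,
    half_lt_self (by positivity)⟩
  set G := convolution (φ.normed volume) g (ContinuousLinearMap.lsmul ℝ ℝ) volume with hGdef
  have hconv : ∀ y, ConvolutionExistsAt (φ.normed volume) g y (ContinuousLinearMap.lsmul ℝ ℝ)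
      volume := fun y =>
    (φ.hasCompactSupport_normed.convolutionExists_left _ φ.continuous_normed
      hgc.locallyIntegrable) y
  refine ⟨G, ?_, ?_, ?_⟩
  · exact φ.hasCompactSupport_normed.contDiff_convolution_left (n := 1) _ φ.contDiff_normed
      hgc.locallyIntegrable
  · intro y
    rw [← dist_eq_norm]
    refine φ.dist_normed_convolution_le hgc.aestronglyMeasurable fun x hx => ?_
    rw [dist_eq_norm]
    refine (hgL x y).trans ?_
    have hx' : ∀ i, ‖x i - y i‖ ≤ κ / (S + 1) := fun i => by
      have : ‖x - y‖ < κ / (S + 1) := by simpa [dist_eq_norm] using hx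
      exact (norm_le_pi_norm (x - y) i).trans this.le
    calc (L : ℝ) * ‖∑ i, (x i - y i) • w i‖ ≤ L * ∑ i, κ / (S + 1) * ‖w i‖ := by
          gcongr
          refine (norm_sum_le _ _).trans (Finset.sum_le_sum fun i _ => ?_)
          rw [norm_smul]; gcongr; exact hx' i
      _ = κ / (S + 1) * S := by rw [← Finset.mul_sum, hS]; ring
      _ ≤ κ := by
          rw [div_mul_eq_mul_div, div_le_iff₀ (by positivity)]; nlinarith
  · intro y y'
    have h1 := hconv y
    have h2 := hconv y'
    simp only [hGdef, convolution_def]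
    rw [← integral_sub h1 h2]
    have hφ := φ.integral_normed (μ := (volume : Measure (ι → ℝ)))
    calc _ ≤ ∫ t, φ.normed volume t * (L * ‖∑ i, (y i - y' i) • w i‖) := by
          refine norm_integral_le_of_norm_le (φ.integrable_normed.mul_const _) (.of_forall fun t => ?_)
          simp only [ContinuousLinearMap.lsmul_apply, ← smul_sub, norm_smul, Real.norm_eq_abs,
            abs_of_nonneg (φ.nonneg_normed t)]
          gcongr
          · exact φ.nonneg_normed t
          · simpa using hgL (y - t) (y' - t)
      _ = _ := by rw [integral_mul_const, hφ, one_mul]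

/-- Linearization of a Lipschitz map over a parallelepiped. -/
theorem exists_linear_average_fin {X : Type*} [NormedAddCommGroup X] [NormedSpace ℝ X]
    [CompleteSpace X] {m : ℕ} (R : X → X) (L : ℝ≥0) (hR : LipschitzWith L R)
    (w : Fin (m + 1) → X) (p : X) {κ : ℝ} (hκ : 0 < κ) (l : Fin (m + 1) → ℝ)
    (hl : ∀ i, 0 < l i) :
    ∃ T : (Fin (m + 1) → ℝ) →ₗ[ℝ] X, (∀ c, ‖T c‖ ≤ L * ‖∑ i, c i • w i‖) ∧
      ∀ (i : Fin (m + 1)) (C : Set X), Convex ℝ C → IsClosed C →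
        (∀ y : Fin (m + 1) → ℝ, (∀ j, 0 ≤ y j ∧ y j ≤ l j) → y i = 0 → ∀ z₀ z₁,
          ‖z₀ - R (p + ∑ j, y j • w j)‖ ≤ κ →
          ‖z₁ - R (p + ∑ j, y j • w j + l i • w i)‖ ≤ κ → z₁ - z₀ ∈ C) →
        l i • T (Pi.single i 1) ∈ C := by
  obtain ⟨G, hG, hGκ, hGL⟩ := exists_contDiff_approx R L hR w p hκ
  obtain ⟨T, hT, hTC⟩ := exists_average_fderiv G hG l hl
  refine ⟨T, fun c => hT c _ fun y => ?_, fun i C hC hCc h => hTC i C hC hCc fun y hy hyi => ?_⟩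
  · have hd : HasDerivAt (fun t : ℝ => G (y + t • c)) (fderiv ℝ G y c) 0 := by
      have h1 : HasFDerivAt G (fderiv ℝ G y) (y + (0 : ℝ) • c) := by
        simpa using (hG.differentiable one_ne_zero y).hasFDerivAt
      have h2 : HasDerivAt (fun t : ℝ => y + t • c) c 0 := by
        simpa using ((hasDerivAt_id (0 : ℝ)).smul_const c).const_add y
      exact h1.comp_hasDerivAt 0 h2
    refine hd.le_of_lip' (by positivity) (.of_forall fun t => ?_)
    have := hGL (y + t • c) (y + (0 : ℝ) • c)
    refine this.trans (le_of_eq ?_)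
    simp [mul_smul, ← Finset.smul_sum, norm_smul]
    ring
  · refine h y hy hyi _ _ (hGκ y) ?_
    have := hGκ (y + Pi.single i (l i))
    convert! this using 4
    rw [add_assoc]
    congr 1
    simp only [Pi.add_apply, add_smul, Finset.sum_add_distrib, Pi.single_apply, ite_smul, zero_smul,
      Finset.sum_ite_eq', Finset.mem_univ, if_true]

/-- Linearization of a Lipschitz map over a parallelepiped. -/
theorem exists_linear_average {X : Type*} [NormedAddCommGroup X] [NormedSpace ℝ X]
    [CompleteSpace X] {ι : Type*} [Fintype ι] [DecidableEq ι] [Nonempty ι]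
    (R : X → X) (L : ℝ≥0) (hR : LipschitzWith L R)
    (w : ι → X) (p : X) {κ : ℝ} (hκ : 0 < κ) (l : ι → ℝ) (hl : ∀ i, 0 < l i) :
    ∃ T : (ι → ℝ) →ₗ[ℝ] X, (∀ c, ‖T c‖ ≤ L * ‖∑ i, c i • w i‖) ∧
      ∀ (i : ι) (C : Set X), Convex ℝ C → IsClosed C →
        (∀ y : ι → ℝ, (∀ j, 0 ≤ y j ∧ y j ≤ l j) → y i = 0 → ∀ z₀ z₁,
          ‖z₀ - R (p + ∑ j, y j • w j)‖ ≤ κ →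
          ‖z₁ - R (p + ∑ j, y j • w j + l i • w i)‖ ≤ κ → z₁ - z₀ ∈ C) →
        l i • T (Pi.single i 1) ∈ C := by
  obtain ⟨m, hm⟩ := Nat.exists_eq_succ_of_ne_zero (Fintype.card_ne_zero (α := ι))
  let e : Fin (m + 1) ≃ ι := ((Fintype.equivFin ι).trans (finCongr hm)).symm
  obtain ⟨T, hT, hTC⟩ := exists_linear_average_fin R L hR (w ∘ e) p hκ (l ∘ e) fun i => hl _
  refine ⟨T ∘ₗ LinearMap.funLeft ℝ ℝ e, fun c => ?_, fun i C hC hCc h => ?_⟩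
  · refine (hT _).trans (le_of_eq ?_)
    rw [← e.sum_comp fun i => c i • w i]
    rfl
  · have := hTC (e.symm i) C hC hCc fun y hy hyi z₀ z₁ h₀ h₁ => by
      refine h (y ∘ e.symm) (fun j => by simpa using hy (e.symm j)) hyi z₀ z₁ ?_ ?_
      · rw [← e.sum_comp]; simpa using h₀
      · rw [← e.sum_comp]; simpa using h₁
    convert! this using 2
    · simp
    · simp only [LinearMap.comp_apply]
      congr 1
      funext j
      simp [LinearMap.funLeft, Pi.single_apply, Equiv.eq_symm_apply]

/-! ### Auerbach bases and nets in finite dimension -/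

/-- Auerbach's lemma. -/
theorem exists_auerbach (E : Type*) [NormedAddCommGroup E] [NormedSpace ℝ E]
    [FiniteDimensional ℝ E] :
    ∃ (v : Fin (Module.finrank ℝ E) → E) (f : Fin (Module.finrank ℝ E) → StrongDual ℝ E),
      (∀ i, ‖v i‖ ≤ 1) ∧ (∀ i, ‖f i‖ ≤ 1) ∧ ∀ x, ∑ i, f i x • v i = x := by
  set d := Module.finrank ℝ E
  let b : Module.Basis (Fin d) ℝ E := Module.finBasis ℝ E
  have hcont : Continuous fun v : Fin d → E => b.det v := by
    simp only [Module.Basis.det_apply]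
    refine Continuous.matrix_det (continuous_matrix fun i j => ?_)
    exact (LinearMap.continuous_of_finiteDimensional (b.coord i)).comp (continuous_apply j)
  have hcomp : IsCompact (Set.univ.pi fun _ : Fin d => Metric.closedBall (0 : E) 1) :=
    isCompact_univ_pi fun _ => isCompact_closedBall _ _
  -- Maximal volume makes the Cramer coordinate functionals `g i` below have norm at most 1.
  obtain ⟨v, hv, hmax⟩ := hcomp.exists_isMaxOn ⟨0, fun i _ => by simp⟩ hcont.abs.continuousOn
  have hmax' : ∀ u : Fin d → E, (∀ i, ‖u i‖ ≤ 1) → |b.det u| ≤ |b.det v| := fun u hu =>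
    hmax fun i _ => by simpa using hu i
  have hv1 : ∀ i, ‖v i‖ ≤ 1 := fun i => by simpa using hv i (Set.mem_univ i)
  have hdet : b.det v ≠ 0 := by
    have h1 := hmax' (fun i => ‖b i‖⁻¹ • b i) fun i => by
      rw [norm_smul, norm_inv, norm_norm, inv_mul_cancel₀ (norm_ne_zero_iff.2 (b.ne_zero i))]
    rw [AlternatingMap.map_smul_univ, b.det_self, smul_eq_mul, mul_one] at h1
    have h2 : 0 < |∏ i, ‖b i‖⁻¹| := abs_pos.2 (Finset.prod_ne_zero_iff.2 fun i _ =>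
      inv_ne_zero (norm_ne_zero_iff.2 (b.ne_zero i)))
    exact abs_pos.1 (h2.trans_le h1)
  let g : Fin d → E →ₗ[ℝ] ℝ := fun i =>
    (b.det v)⁻¹ • b.det.toMultilinearMap.toLinearMap v i
  have hg : ∀ i x, g i x = (b.det v)⁻¹ * b.det (Function.update v i x) := fun i x => rfl
  have hgn : ∀ i x, ‖g i x‖ ≤ 1 * ‖x‖ := by
    intro i x
    rcases eq_or_ne x 0 with rfl | hx
    · simp
    have hx' := norm_pos_iff.2 hx
    have h1 : ‖g i (‖x‖⁻¹ • x)‖ ≤ 1 := by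
      rw [hg, Real.norm_eq_abs, abs_mul, abs_inv, inv_mul_le_iff₀ (abs_pos.2 hdet), mul_one]
      refine hmax' _ fun j => ?_
      rcases eq_or_ne j i with rfl | hj
      · simp [norm_smul, hx'.ne']
      · simpa [hj] using hv1 j
    rw [map_smul, norm_smul, norm_inv, norm_norm, inv_mul_le_iff₀ hx', mul_one] at h1
    linarith
  obtain ⟨hli, hsp⟩ := (b.is_basis_iff_det (v := v)).2 (isUnit_iff_ne_zero.2 hdet)
  let b' := Module.Basis.mk hli hsp.ge
  have hb' : ∀ i, b' i = v i := fun i => by simp [b']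
  have hdelta : ∀ i j, g i (v j) = if j = i then 1 else 0 := by
    intro i j
    rw [hg]
    split_ifs with h
    · subst h; rw [Function.update_eq_self, inv_mul_cancel₀ hdet]
    · have := b.det.map_eq_zero_of_eq (Function.update v i (v j)) (i := i) (j := j)
        (by simp [Function.update_of_ne h]) (Ne.symm h)
      rw [this, mul_zero]
  refine ⟨v, fun i => (g i).mkContinuous 1 (hgn i), hv1,
    fun i => LinearMap.mkContinuous_norm_le _ zero_le_one _, fun x => ?_⟩
  have : ∑ i, (g i).smulRight (v i) = LinearMap.id := b'.ext fun j => by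
    simp [hb', hdelta]
  simpa using LinearMap.congr_fun this x

open MeasureTheory Metric ENNReal in
/-- Volume bound for separated subsets of the unit ball. -/
theorem card_le_of_separated_unitBall {E : Type*} [NormedAddCommGroup E] [NormedSpace ℝ E]
    [FiniteDimensional ℝ E] {ε : ℝ} (hε : 0 < ε) (s : Finset E) (hs : ∀ c ∈ s, ‖c‖ ≤ 1)
    (h : ∀ c ∈ s, ∀ d ∈ s, c ≠ d → ε ≤ ‖c - d‖) :
    (s.card : ℝ) ≤ (1 + 2 / ε) ^ Module.finrank ℝ E := by
  borelize E
  let μ : Measure E := Measure.addHaar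
  have hδ : 0 < ε / 2 := by positivity
  have hρ : 0 < 1 + ε / 2 := by positivity
  have hD : Set.Pairwise (s : Set E) (Function.onFun Disjoint fun c => ball c (ε / 2)) := by
    rintro c hc d hd hcd
    apply ball_disjoint_ball
    rw [dist_eq_norm, add_halves]
    exact h c hc d hd hcd
  have hA : ⋃ c ∈ s, ball c (ε / 2) ⊆ ball (0 : E) (1 + ε / 2) := by
    refine Set.iUnion₂_subset fun x hx => ball_subset_ball' ?_
    rw [dist_zero_right]
    linarith [hs x hx]
  have I : (s.card : ℝ≥0∞) * ENNReal.ofReal ((ε / 2) ^ Module.finrank ℝ E) * μ (ball 0 1) ≤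
      ENNReal.ofReal ((1 + ε / 2) ^ Module.finrank ℝ E) * μ (ball 0 1) :=
    calc
      _ = μ (⋃ c ∈ s, ball c (ε / 2)) := by
        rw [measure_biUnion_finset hD fun c _ => measurableSet_ball]
        simp only [μ.addHaar_ball_of_pos _ hδ]
        simp only [Finset.sum_const, nsmul_eq_mul, mul_assoc]
      _ ≤ μ (ball (0 : E) (1 + ε / 2)) := measure_mono hA
      _ = _ := by simp only [μ.addHaar_ball_of_pos _ hρ]
  have J := (ENNReal.mul_le_mul_iff_left (measure_ball_pos μ 0 zero_lt_one).ne'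
    measure_ball_lt_top.ne).1 I
  have K := ENNReal.toReal_le_of_le_ofReal (pow_nonneg hρ.le _) J
  rw [ENNReal.toReal_mul, ENNReal.toReal_natCast, ENNReal.toReal_ofReal (by positivity),
    ← le_div_iff₀ (by positivity), ← div_pow] at K
  convert! K using 2
  field_simp
  ring

/-- The unit ball of a finite-dimensional space has an `ε`-net with at most `(1 + 2 / ε) ^ dim`
points. -/
theorem exists_net_unitBall (E : Type*) [NormedAddCommGroup E] [NormedSpace ℝ E]
    [FiniteDimensional ℝ E] {ε : ℝ} (hε : 0 < ε) :
    ∃ s : Finset E, (∀ c ∈ s, ‖c‖ ≤ 1) ∧ (∀ x : E, ‖x‖ ≤ 1 → ∃ c ∈ s, ‖x - c‖ ≤ ε) ∧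
      (s.card : ℝ) ≤ (1 + 2 / ε) ^ Module.finrank ℝ E := by
  classical
  let P : Finset E → Prop := fun s =>
    (∀ c ∈ s, ‖c‖ ≤ 1) ∧ ∀ c ∈ s, ∀ d ∈ s, c ≠ d → ε ≤ ‖c - d‖
  have hbd : BddAbove {n | ∃ s, P s ∧ s.card = n} := by
    refine ⟨⌊(1 + 2 / ε) ^ Module.finrank ℝ E⌋₊, ?_⟩
    rintro n ⟨s, hs, rfl⟩
    exact Nat.le_floor (card_le_of_separated_unitBall hε s hs.1 hs.2)
  have hne : {n | ∃ s, P s ∧ s.card = n}.Nonempty := ⟨0, ∅, by simp [P], rfl⟩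
  -- A separated set of maximal cardinality is a net.
  obtain ⟨s, hs, hsn⟩ := Nat.sSup_mem hne hbd
  refine ⟨s, hs.1, fun x hx => ?_, card_le_of_separated_unitBall hε s hs.1 hs.2⟩
  by_contra! hcon
  have hxs : x ∉ s := fun hxs => by
    have := hcon x hxs
    simp at this; linarith
  have hP : P (insert x s) := by
    refine ⟨fun c hc => ?_, fun c hc d hd hcd => ?_⟩
    · rcases Finset.mem_insert.1 hc with rfl | hc
      exacts [hx, hs.1 c hc]
    · rw [Finset.mem_insert] at hc hd
      rcases hc with rfl | hc <;> rcases hd with rfl | hd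
      · exact absurd rfl hcd
      · exact (hcon d hd).le
      · rw [norm_sub_rev]; exact (hcon c hc).le
      · exact hs.2 c hc d hd hcd
  have := le_csSup hbd ⟨_, hP, rfl⟩
  rw [Finset.card_insert_of_notMem hxs] at this
  omega

/-! ### Trace duality -/

/-- Trace duality: a subspace `E` that is complemented, with a uniform bound on vectors indexed by a
fixed finite family of functionals on `E`, is the range of a projection that is bounded
along these functionals. -/
theorem exists_projection_of_forall_finite {X : Type*} [NormedAddCommGroup X] [NormedSpace ℝ X]
    (E : Submodule ℝ X) {d : ℕ} (v : Fin d → E) (f : Fin d → StrongDual ℝ E)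
    (hvf : ∀ x, ∑ i, f i x • v i = x)
    {J : Type*} [Fintype J] [DecidableEq J] (a : J → StrongDual ℝ E) (ha : ∀ k, ‖a k‖ ≤ 1)
    (j : Fin d → J) (haj : ∀ i, a (j i) = f i) {C : ℝ} (hC : 0 ≤ C)
    (hT : ∀ w : J → X, (∀ k, ‖w k‖ ≤ 1) →
      ∃ T : X →ₗ[ℝ] E, (∀ e : E, T e = e) ∧ ∀ k, ‖T (w k)‖ ≤ C) :
    ∃ P : X →L[ℝ] E, (∀ e : E, P e = e) ∧ ∀ k x, |a k (P x)| ≤ C * ‖x‖ := by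
  have hav : ∀ (b : StrongDual ℝ E) (e : E), ∑ i, b (v i) * f i e = b e := fun b e => by
    conv_rhs => rw [← hvf e]
    simp [mul_comm]
  choose F hFext hFn using fun i => exists_extension_norm_eq E (f i)
  -- A family x stands for the operator Σ a_k ⊗ x_k from E to X, whose value at `v i` is `y i x`.
  -- `Z` consists of those with values in E, and `τ` is their trace.
  let y : Fin d → (J → X) →ₗ[ℝ] X := fun i =>
    ∑ k, (a k (v i)) • LinearMap.proj k
  have hy : ∀ i x, y i x = ∑ k, a k (v i) • x k := fun i x => by simp [y]
  let Z : Submodule ℝ (J → X) := ⨅ i, E.comap (y i)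
  have hZ : ∀ x, x ∈ Z ↔ ∀ i, y i x ∈ E := fun x => by simp [Z]
  let τ : (J → X) →ₗ[ℝ] ℝ := ∑ i, (F i : X →ₗ[ℝ] ℝ) ∘ₗ y i
  have hτ : ∀ x, τ x = ∑ i, F i (y i x) := fun x => by simp [τ]
  have hbound : ∀ x ∈ Z, τ x ≤ C * ∑ k, ‖x k‖ := by
    intro x hx
    obtain ⟨T, hTE, hTw⟩ := hT (fun k => ‖x k‖⁻¹ • x k) fun k => by
      rw [norm_smul, norm_inv, norm_norm]; exact inv_mul_le_one
    have hTx : ∀ k, ‖T (x k)‖ ≤ C * ‖x k‖ := fun k => by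
      rcases eq_or_ne (x k) 0 with h | h
      · simp [h]
      · have h' := norm_pos_iff.2 h
        have := hTw k
        rwa [map_smul, norm_smul, norm_inv, norm_norm, inv_mul_le_iff₀ h', mul_comm] at this
    -- `T` fixes `y i x`, so the trace becomes Σ a_k(T x_k).
    have h1 : ∀ i, F i (y i x) = ∑ k, a k (v i) * f i (T (x k)) := fun i => by
      have hm := (hZ x).1 hx i
      have h2 : T (y i x) = (⟨y i x, hm⟩ : E) := hTE ⟨y i x, hm⟩
      rw [hFext i ⟨y i x, hm⟩, ← h2, hy]
      simp
    rw [hτ]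
    simp only [h1]
    rw [Finset.sum_comm, Finset.mul_sum]
    refine Finset.sum_le_sum fun k _ => ?_
    rw [hav]
    refine (le_abs_self _).trans (((a k).le_opNorm _).trans ?_)
    calc ‖a k‖ * ‖T (x k)‖ ≤ 1 * ‖T (x k)‖ := by gcongr; exact ha k
      _ ≤ _ := by rw [one_mul]; exact hTx k
  obtain ⟨g, hgZ, hgN⟩ := exists_extension_of_le_sublinear ⟨Z, τ.domRestrict Z⟩
    (fun x => C * ∑ k, ‖x k‖)
    (fun c hc x => by simp [norm_smul, abs_of_pos hc, ← Finset.mul_sum]; ring)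
    (fun x x' => by
      rw [← mul_add, ← Finset.sum_add_distrib]
      gcongr
      exact norm_add_le _ _)
    (fun x => hbound x x.2)
  have hgZ' : ∀ x ∈ Z, g x = τ x := fun x hx => hgZ ⟨x, hx⟩
  have hg1 : ∀ k x, g (Pi.single k x) ≤ C * ‖x‖ := fun k x => by
    refine (hgN _).trans (le_of_eq ?_)
    rw [Finset.sum_eq_single k] <;> simp +contextual
  let φ : J → X →L[ℝ] ℝ := fun k => (g ∘ₗ LinearMap.single ℝ (fun _ : J => X) k).mkContinuous C
    fun x => by
      refine abs_le'.2 ⟨hg1 k x, ?_⟩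
      have := hg1 k (-x)
      simpa [Pi.single_neg] using this
  have hφ : ∀ k x, φ k x = g (Pi.single k x) := fun k x => rfl
  have hφn : ∀ k x, |φ k x| ≤ C * ‖x‖ := fun k x =>
    ((φ k).le_opNorm x).trans (by gcongr; exact LinearMap.mkContinuous_norm_le _ hC _)
  have hys : ∀ i k x, y i (Pi.single k x) = a k (v i) • x := fun i k x => by
    rw [hy, Finset.sum_eq_single k] <;> simp +contextual
  refine ⟨∑ i, (φ (j i)).smulRight (v i), fun e => ?_, fun k x => ?_⟩
  · have : ∀ i, φ (j i) e = f i e := fun i => by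
      rw [hφ, hgZ' _ ((hZ _).2 fun i' => by rw [hys]; exact E.smul_mem _ e.2), hτ]
      simp only [hys, haj, map_smul, smul_eq_mul, hFext]
      exact hav (f i) e
    simp [this, hvf]
  -- Since a_k = Σ a_k(v_i) f_i, this family represents the zero operator. Hence a_k ∘ P = φ_k.
  · have hz : g (Pi.single k x - ∑ i, a k (v i) • (Pi.single (j i) x : J → X)) = 0 := by
      have hy0 : ∀ i', y i' (Pi.single k x - ∑ i, a k (v i) • (Pi.single (j i) x : J → X)) = 0 := fun i' => by
        rw [map_sub, map_sum]
        simp only [map_smul, hys, haj, smul_smul, ← Finset.sum_smul]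
        rw [hav, sub_self]
      rw [hgZ' _ ((hZ _).2 fun i' => by rw [hy0]; exact E.zero_mem), hτ]
      simp [hy0]
    rw [map_sub, map_sum, sub_eq_zero] at hz
    have : a k ((∑ i, (φ (j i)).smulRight (v i)) x) = φ k x := by
      rw [hφ, hz]
      simp [hφ, mul_comm]
    rw [this]
    exact hφn k x

/-! ### From the retraction to bounded projections -/

/-- A map that factors through a linear map up to kernels extends to a linear map. -/
theorem exists_linearMap_comp_eq {V W Y : Type*} [AddCommGroup V] [Module ℝ V] [AddCommGroup W]
    [Module ℝ W] [AddCommGroup Y] [Module ℝ Y] (π : V →ₗ[ℝ] W) (T : V →ₗ[ℝ] Y)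
    (h : LinearMap.ker π ≤ LinearMap.ker T) : ∃ S : W →ₗ[ℝ] Y, ∀ c, S (π c) = T c := by
  obtain ⟨S, hS⟩ := LinearMap.exists_extend
    (((LinearMap.ker π).liftQ T h) ∘ₗ (π.quotKerEquivRange.symm : LinearMap.range π →ₗ[ℝ] _))
  refine ⟨S, fun c => ?_⟩
  have h1 := LinearMap.congr_fun hS ⟨π c, LinearMap.mem_range_self π c⟩
  have h2 : π.quotKerEquivRange.symm ⟨π c, LinearMap.mem_range_self π c⟩
      = (LinearMap.ker π).mkQ c := π.quotKerEquivRange_symm_apply_image c _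
  simpa [h2] using h1

/-- Linearizing a Lipschitz retraction near a large ball of `E`. -/
theorem exists_linear_projection_of_retraction {X : Type*} [NormedAddCommGroup X]
    [NormedSpace ℝ X] [CompleteSpace X] (E : Submodule ℝ X) [FiniteDimensional ℝ E] {d : ℕ}
    (hd : 0 < d) (v : Fin d → E) (f : Fin d → StrongDual ℝ E) (hv : ∀ i, ‖v i‖ ≤ 1)
    (hf : ∀ i, ‖f i‖ ≤ 1) (hvf : ∀ x, ∑ i, f i x • v i = x)
    (R : X → X) (L : ℝ≥0) (hR : LipschitzWith L R) {h r : ℝ} (hh : 0 < h) (hr : 0 < r)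
    (hRE : ∀ x, Metric.infDist (R x) E ≤ h) (p : X) (hp : p ∈ E)
    (hball : ∀ x ∈ E, ‖x - p‖ ≤ r → R x = x)
    {J : Type*} [Fintype J] [DecidableEq J] (w : J → X) (hw : ∀ k, ‖w k‖ ≤ 1)
    (hsmall : 4 * d ^ 3 * (L * (Fintype.card J * (d * h)) + h) ≤ r) :
    ∃ T : X →ₗ[ℝ] E, (∀ e : E, T e = e) ∧ ∀ k, ‖T (w k)‖ ≤ 2 * (L + 8) := by
  have hd' : (0 : ℝ) < d := by exact_mod_cast hd
  have hd1 : (1 : ℝ) ≤ d := by exact_mod_cast hd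
  have : Nonempty (Fin d ⊕ J) := ⟨Sum.inl ⟨0, hd⟩⟩
  choose F hFext hFn using fun i => exists_extension_norm_eq E (f i)
  let P : X →L[ℝ] E := ∑ i, (F i).smulRight (v i)
  have hP : ∀ x, P x = ∑ i, F i x • v i := fun x => by simp [P]
  have hPE : ∀ e : E, P e = e := fun e => by rw [hP]; simp only [hFext, hvf]
  have hPn : ∀ x, ‖P x‖ ≤ d * ‖x‖ := fun x => by
    rw [hP]
    refine (norm_sum_le _ _).trans ?_
    calc ∑ i, ‖F i x • v i‖ ≤ ∑ _i : Fin d, ‖x‖ := by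
          refine Finset.sum_le_sum fun i _ => ?_
          rw [norm_smul]
          calc ‖F i x‖ * ‖v i‖ ≤ (1 * ‖x‖) * 1 := by
                gcongr
                · exact (F i).le_of_opNorm_le (by rw [hFn]; exact hf i) x
                · exact hv i
            _ = ‖x‖ := by ring
      _ = d * ‖x‖ := by simp
  let Q : X →L[ℝ] X := ContinuousLinearMap.id ℝ X - E.subtypeL ∘L P
  have hQ : ∀ x, Q x = x - P x := fun x => rfl
  have hQE : ∀ e ∈ E, Q e = 0 := fun e he => by
    rw [hQ, hPE ⟨e, he⟩, sub_self]
  have hQn : ∀ x, ‖Q x‖ ≤ (1 + d) * ‖x‖ := fun x => by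
    rw [hQ]
    refine (norm_sub_le _ _).trans ?_
    have := hPn x
    rw [← Submodule.coe_norm]
    linarith
  have hQR : ∀ x, ‖Q (R x)‖ ≤ (1 + d) * h := fun x => by
    refine le_of_forall_pos_le_add fun η hη => ?_
    obtain ⟨e, he, hlt⟩ := (Metric.infDist_lt_iff ⟨0, E.zero_mem⟩).1
      ((hRE x).trans_lt (lt_add_of_pos_right h (div_pos hη (by positivity : (0 : ℝ) < 1 + d))))
    have h1 : Q (R x) = Q (R x - e) := by rw [map_sub, hQE e he, sub_zero]
    rw [h1]
    refine (hQn _).trans ?_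
    rw [← dist_eq_norm]
    calc (1 + (d : ℝ)) * dist (R x) e ≤ (1 + d) * (h + η / (1 + d)) := by gcongr
      _ = _ := by field_simp
  let u : Fin d ⊕ J → X := Sum.elim (fun i => (v i : X)) w
  -- Edges `r / d` keep the E-part of the box in the ball of radius `r`. Thickness `d * h` cancels
  -- the factor (1 + d)h bounding `Q ∘ R`, leaving 4(1 + d)/d ≤ 8.
  let l : Fin d ⊕ J → ℝ := Sum.elim (fun _ => r / d) (fun _ => d * h)
  have hl : ∀ i, 0 < l i := by
    rintro (i | k)
    · exact div_pos hr hd'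
    · exact mul_pos hd' hh
  obtain ⟨T₀, hT₀, hT₀C⟩ := exists_linear_average R L hR u p hh l hl
  let π : (Fin d ⊕ J → ℝ) →ₗ[ℝ] X := ∑ i, (LinearMap.proj i).smulRight (u i)
  have hπ : ∀ c, π c = ∑ i, c i • u i := fun c => by simp [π]
  obtain ⟨T₁, hT₁⟩ := exists_linearMap_comp_eq π T₀ fun c hc => by
    rw [LinearMap.mem_ker] at hc ⊢
    have := hT₀ c
    rw [← hπ, hc, norm_zero, mul_zero] at this
    exact norm_le_zero_iff.1 this
  have hT₁u : ∀ i, T₁ (u i) = T₀ (Pi.single i 1) := fun i => by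
    rw [← hT₁, hπ, Finset.sum_eq_single i] <;> simp +contextual
  set A : ℝ := L * (Fintype.card J * (d * h)) with hA
  have hA0 : 0 ≤ A := by positivity
  -- transversal directions
  have hw1 : ∀ k, ‖P (T₁ (w k))‖ ≤ L + 8 := by
    intro k
    have hTw : ‖T₁ (w k)‖ ≤ L := by
      have := hT₀ (Pi.single (Sum.inr k) 1)
      rw [← hπ, ← hT₁] at this
      have e1 : π (Pi.single (Sum.inr k) 1) = w k := by
        rw [hπ, Finset.sum_eq_single (Sum.inr k)] <;> simp +contextual [u]
      rw [e1] at this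
      exact this.trans (mul_le_of_le_one_right L.2 (hw k))
    have hmem := hT₀C (Sum.inr k) (Q ⁻¹' Metric.closedBall 0 ((1 + d) * (4 * h)))
      ((convex_closedBall _ _).linear_preimage (Q : X →ₗ[ℝ] X))
      (Metric.isClosed_closedBall.preimage Q.continuous) (by
        intro y _ _ z₀ z₁ h₀ h₁
        have key : ∀ z x, ‖z - R x‖ ≤ h → ‖Q z‖ ≤ (1 + d) * (2 * h) := fun z x hz => by
          have e : Q z = Q (z - R x) + Q (R x) := by rw [map_sub]; abel
          rw [e]
          have h2 : ‖Q (z - R x)‖ ≤ (1 + d) * h := (hQn _).trans (by gcongr)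
          linarith [norm_add_le (Q (z - R x)) (Q (R x)), hQR x]
        rw [Set.mem_preimage, mem_closedBall_zero_iff, map_sub]
        linarith [norm_sub_le (Q z₁) (Q z₀), key _ _ h₀, key _ _ h₁])
    rw [← hT₁u, Set.mem_preimage, mem_closedBall_zero_iff, map_smul, norm_smul, Real.norm_eq_abs,
      abs_of_pos (hl _)] at hmem
    change d * h * ‖Q (T₁ (w k))‖ ≤ _ at hmem
    have h3 : ‖Q (T₁ (w k))‖ ≤ 8 := by
      have h4 : d * h * ‖Q (T₁ (w k))‖ ≤ d * h * 8 := by nlinarith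
      exact le_of_mul_le_mul_left h4 (by positivity)
    have e : ((P (T₁ (w k)) : E) : X) = T₁ (w k) - Q (T₁ (w k)) := by rw [hQ]; abel
    rw [Submodule.coe_norm, e]
    linarith [norm_sub_le (T₁ (w k)) (Q (T₁ (w k)))]
  -- directions of `E`
  have hv1 : ∀ i, ‖T₁ (v i) - v i‖ ≤ 2 * (A + h) * d / r := by
    intro i
    -- At each end, the transversal shift costs at most `A` and mollification at most `h`.
    have hmem := hT₀C (Sum.inl i) (Metric.closedBall ((r / d) • (v i : X)) (2 * (A + h)))
      (convex_closedBall _ _) Metric.isClosed_closedBall (by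
        intro y hy hyi z₀ z₁ h₀ h₁
        have hbox : ∀ c : Fin d → ℝ, (∀ i, 0 ≤ c i ∧ c i ≤ r / d) →
            R (p + ∑ i, c i • (v i : X)) = p + ∑ i, c i • (v i : X) := fun c hc => by
          refine hball _ (E.add_mem hp (E.sum_mem fun i _ => E.smul_mem _ (v i).2)) ?_
          rw [add_sub_cancel_left]
          calc ‖∑ i, c i • (v i : X)‖ ≤ ∑ _i : Fin d, r / d := by
                refine (norm_sum_le _ _).trans (Finset.sum_le_sum fun i _ => ?_)
                rw [norm_smul, Real.norm_eq_abs, abs_of_nonneg (hc i).1]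
                calc c i * ‖(v i : X)‖ ≤ r / d * 1 := by
                      gcongr
                      · exact (hc i).2
                      · exact hv i
                  _ = r / d := mul_one _
            _ = r := by simp; field_simp
        set e₀ : X := p + ∑ i, y (Sum.inl i) • (v i : X) with he₀
        set b : X := ∑ k, y (Sum.inr k) • w k with hb
        have hbn : ‖b‖ ≤ Fintype.card J * (d * h) := by
          calc ‖b‖ ≤ ∑ _k : J, d * h := by
                refine (norm_sum_le _ _).trans (Finset.sum_le_sum fun k _ => ?_)
                have hk := hy (Sum.inr k)
                rw [norm_smul, Real.norm_eq_abs, abs_of_nonneg hk.1]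
                calc y (Sum.inr k) * ‖w k‖ ≤ d * h * 1 := by
                      gcongr
                      · exact hk.2
                      · exact hw k
                  _ = d * h := mul_one _
            _ = _ := by simp
        have hx : p + ∑ j, y j • u j = e₀ + b := by
          rw [Fintype.sum_sum_type, ← add_assoc]
          rfl
        rw [hx] at h₀ h₁
        have hR0 : R e₀ = e₀ := hbox _ fun i => hy (Sum.inl i)
        have hR1 : R (e₀ + (r / d) • (v i : X)) = e₀ + (r / d) • (v i : X) := by
          have e1 : e₀ + (r / d) • (v i : X)
              = p + ∑ i', (y (Sum.inl i') + (Pi.single i (r / d) : Fin d → ℝ) i') • (v i' : X) := by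
            simp only [add_smul, Finset.sum_add_distrib, Pi.single_apply, ite_smul, zero_smul,
              Finset.sum_ite_eq', Finset.mem_univ, if_true]
            rw [he₀, add_assoc]
          rw [e1]
          refine hbox _ fun i' => ?_
          rcases eq_or_ne i' i with rfl | hne
          · simp [hyi, (div_pos hr hd').le]
          · simpa [hne, l] using hy (Sum.inl i')
        have hnear : ∀ e : X, R e = e → ‖R (e + b) - e‖ ≤ A := fun e he => by
          have := hR.norm_sub_le (e + b) e
          rw [he, add_sub_cancel_left] at this
          exact this.trans (by rw [hA]; gcongr)
        have n0 := hnear _ hR0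
        have n1 := hnear _ hR1
        rw [mem_closedBall_iff_norm]
        have e2 : z₁ - z₀ - (r / d) • (v i : X) =
            (z₁ - R (e₀ + b + l (Sum.inl i) • u (Sum.inl i)))
            + (R (e₀ + (r / d) • (v i : X) + b) - (e₀ + (r / d) • (v i : X)))
            - ((z₀ - R (e₀ + b)) + (R (e₀ + b) - e₀)) := by
          have : e₀ + b + l (Sum.inl i) • u (Sum.inl i) = e₀ + (r / d) • (v i : X) + b := by
            simp only [l, u, Sum.elim_inl]; abel
          rw [this]; abel
        rw [e2]
        refine (norm_sub_le _ _).trans ?_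
        linarith [norm_add_le (z₁ - R (e₀ + b + l (Sum.inl i) • u (Sum.inl i)))
            (R (e₀ + (r / d) • (v i : X) + b) - (e₀ + (r / d) • (v i : X))),
          norm_add_le (z₀ - R (e₀ + b)) (R (e₀ + b) - e₀)])
    rw [← hT₁u, mem_closedBall_iff_norm] at hmem
    change ‖(r / d) • T₁ (v i) - _‖ ≤ _ at hmem
    rw [← smul_sub, norm_smul, Real.norm_eq_abs, abs_of_pos (div_pos hr hd')] at hmem
    rw [le_div_iff₀ hr]
    calc ‖T₁ (v i) - v i‖ * r = (r / d * ‖T₁ (v i) - v i‖) * d := by field_simp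
      _ ≤ _ := by gcongr
  let S : E →ₗ[ℝ] E := (P : X →ₗ[ℝ] E) ∘ₗ T₁ ∘ₗ E.subtype
  have hS : ∀ e : E, S e = P (T₁ e) := fun e => rfl
  -- One factor `d` each comes from the norm of `P`, the number of summands and the edge `r / d`.
  have hS1 : ∀ e, ‖S e - e‖ ≤ 1 / 2 * ‖e‖ := by
    intro e
    have e1 : S e - e = P (∑ i, f i e • (T₁ (v i) - v i)) := by
      have e2 : (e : X) = ∑ i, f i e • (v i : X) := by
        conv_lhs => rw [← hvf e]
        simp
      have e3 : ∑ i, f i e • (T₁ (v i) - v i) = T₁ e - e := by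
        conv_rhs => rw [e2]
        simp [smul_sub]
      rw [e3, map_sub, hPE, hS]
    rw [e1]
    refine (hPn _).trans ?_
    calc d * ‖∑ i, f i e • (T₁ (v i) - v i)‖
        ≤ d * ∑ _i : Fin d, ‖e‖ * (2 * (A + h) * d / r) := by
          gcongr
          refine (norm_sum_le _ _).trans (Finset.sum_le_sum fun i _ => ?_)
          rw [norm_smul]
          gcongr
          · simpa using (f i).le_of_opNorm_le (hf i) e
          · exact hv1 i
      _ = (2 * d ^ 3 * (A + h) / r) * ‖e‖ := by simp; ring
      _ ≤ 1 / 2 * ‖e‖ := by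
          refine mul_le_mul_of_nonneg_right ?_ (norm_nonneg e)
          rw [div_le_iff₀ hr]
          linarith
  have hS2 : ∀ e, ‖e‖ ≤ 2 * ‖S e‖ := fun e => by
    have h1 := hS1 e
    have h2 : e = S e - (S e - e) := by abel
    have h3 : ‖e‖ ≤ ‖S e‖ + ‖S e - e‖ := by
      conv_lhs => rw [h2]
      exact norm_sub_le _ _
    linarith
  have hinj : Function.Injective S := (injective_iff_map_eq_zero S).2 fun e he => by
    have := hS2 e
    rw [he, norm_zero, mul_zero] at this
    exact norm_le_zero_iff.1 this
  let Se := LinearEquiv.ofInjectiveEndo S hinj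
  have hSe : ∀ e, Se e = S e := fun e => rfl
  refine ⟨(Se.symm : E →ₗ[ℝ] E) ∘ₗ (P : X →ₗ[ℝ] E) ∘ₗ T₁, fun e => ?_, fun k => ?_⟩
  · change Se.symm (P (T₁ e)) = e
    rw [← hS, ← hSe, LinearEquiv.symm_apply_apply]
  · change ‖Se.symm (P (T₁ (w k)))‖ ≤ _
    refine (hS2 _).trans ?_
    rw [← hSe, LinearEquiv.apply_symm_apply]
    exact mul_le_mul_of_nonneg_left (hw1 k) zero_le_two

/-- A finite-dimensional subspace is complemented, with a bound depending only on the Lipschitz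
constant and `ε`, as soon as there is a Lipschitz map fixing a ball of it whose values are
sufficiently close to it. -/
theorem exists_bounded_projection_of_retraction {X : Type*} [NormedAddCommGroup X]
    [NormedSpace ℝ X] [CompleteSpace X] (E : Submodule ℝ X) [FiniteDimensional ℝ E] {n : ℕ}
    (hn : Module.finrank ℝ E ≤ n) {ε : ℝ} (hε : 0 < ε) (hε1 : ε < 1)
    (R : X → X) (L : ℝ≥0) (hR : LipschitzWith L R) {h r : ℝ} (hh : 0 < h) (hr : 0 < r)
    (hRE : ∀ x, Metric.infDist (R x) E ≤ h) (p : X) (hp : p ∈ E)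
    (hball : ∀ x ∈ E, ‖x - p‖ ≤ r → R x = x)
    (hsmall : 4 * n ^ 3 * (L * ((n + (1 + 2 / ε) ^ n) * (n * h)) + h) ≤ r) :
    ∃ P : X →L[ℝ] E, (∀ e : E, P e = e) ∧ ∀ x, ‖P x‖ ≤ 2 * (L + 8) / (1 - ε) * ‖x‖ := by
  classical
  have hε' : 0 < 1 - ε := sub_pos.2 hε1
  rcases Nat.eq_zero_or_pos (Module.finrank ℝ E) with hd | hd
  · have : Subsingleton E := Module.finrank_zero_iff.1 hd
    refine ⟨0, fun e => Subsingleton.elim _ _, fun x => ?_⟩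
    rw [zero_apply, norm_zero]
    positivity
  obtain ⟨v, f, hv, hf, hvf⟩ := exists_auerbach E
  obtain ⟨s, hs1, hs2, hs3⟩ := exists_net_unitBall (StrongDual ℝ E) hε
  have hfr : Module.finrank ℝ (StrongDual ℝ E) = Module.finrank ℝ E := by
    rw [← (LinearMap.toContinuousLinearMap (𝕜 := ℝ) (E := E) (F' := ℝ)).finrank_eq]
    exact Subspace.dual_finrank_eq
  rw [hfr] at hs3
  have hdn : (Module.finrank ℝ E : ℝ) ≤ n := by exact_mod_cast hn
  have hbase : 1 ≤ 1 + 2 / ε := le_add_of_nonneg_right (by positivity)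
  have hcard : (Fintype.card (Fin (Module.finrank ℝ E) ⊕ s) : ℝ) ≤ n + (1 + 2 / ε) ^ n := by
    rw [Fintype.card_sum, Fintype.card_fin, Fintype.card_coe]
    push_cast
    exact add_le_add hdn (hs3.trans (pow_le_pow_right₀ hbase hn))
  -- The left summand supplies the Auerbach functionals needed to build `P`, the right one the net.
  obtain ⟨P, hPE, hP⟩ := exists_projection_of_forall_finite E v f hvf
    (J := Fin (Module.finrank ℝ E) ⊕ s) (Sum.elim f fun c => c)
    (by rintro (i | c); exacts [hf i, hs1 _ c.2]) Sum.inl (fun _ => rfl)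
    (C := 2 * (L + 8)) (by positivity) fun w hw =>
      exists_linear_projection_of_retraction E hd v f hv hf hvf R L hR hh hr hRE p hp hball w hw
        (le_trans (by gcongr) hsmall)
  refine ⟨P, hPE, fun x => ?_⟩
  -- Replacing a norming functional by a net point loses at most `ε * ‖P x‖`, which is absorbed.
  obtain ⟨g, hg1, hgx⟩ := exists_dual_vector'' ℝ (P x)
  obtain ⟨c, hc, hgc⟩ := hs2 g hg1
  have h1 : |c (P x)| ≤ 2 * (L + 8) * ‖x‖ := hP (Sum.inr ⟨c, hc⟩) x
  have h2 : |(g - c) (P x)| ≤ ε * ‖P x‖ := (g - c).le_of_opNorm_le hgc _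
  have h3 : ‖P x‖ = c (P x) + (g - c) (P x) := by
    have : g (P x) = ‖P x‖ := hgx
    rw [_root_.sub_apply, this]; ring
  rw [div_mul_eq_mul_div, le_div_iff₀ hε']
  linarith [le_abs_self (c (P x)), le_abs_self ((g - c) (P x))]

/-- The smallness bound for `ε` beats any polynomial factor after enlarging `ε`. -/
theorem eventually_polynomial_mul_pow_le {ε ε' : ℝ} (hε : 0 < ε) (hεε' : ε < ε') (L : ℝ≥0) :
    ∀ᶠ n : ℕ in atTop,
      8 * (n : ℝ) ^ 3 * (L * ((n + (1 + 2 / ε') ^ n) * n) + 1)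
        ≤ 2 * (n : ℝ) ^ 2 * ((1 + 2 / ε) ^ n + 2) := by
  have hε' : 0 < ε' := hε.trans hεε'
  set b := 1 + 2 / ε with hb
  set b' := 1 + 2 / ε' with hb'
  have hb0 : 0 < b := by positivity
  have hb1 : 1 ≤ b' := le_add_of_nonneg_right (by positivity)
  have hbb : b' < b := by
    have := div_lt_div_of_pos_left (zero_lt_two' ℝ) hε hεε'
    linarith
  have hq : |b' / b| < 1 := by
    rw [abs_of_pos (by positivity), div_lt_one hb0]; exact hbb
  -- Power 5: three from the prefactor, one from the thickness, one from bounding n + b'^n by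
  -- 2n·b'^n.
  have ht := (tendsto_pow_const_mul_const_pow_of_abs_lt_one 5 hq).const_mul (8 * (2 * (L : ℝ) + 1))
  rw [mul_zero] at ht
  filter_upwards [ht.eventually_lt_const one_pos, eventually_ge_atTop 1] with n hn hn1
  have hn1' : (1 : ℝ) ≤ n := by exact_mod_cast hn1
  have hp1 : 1 ≤ b' ^ n := one_le_pow₀ hb1
  have h1 : 8 * (2 * (L : ℝ) + 1) * (n ^ 5 * b' ^ n) ≤ b ^ n := by
    rw [div_pow, ← mul_div_assoc, ← mul_div_assoc, div_lt_one (by positivity)] at hn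
    exact hn.le
  have h2 : (n : ℝ) + b' ^ n ≤ 2 * (n * b' ^ n) := by nlinarith
  have h3 : (1 : ℝ) ≤ n ^ 2 * b' ^ n := one_le_mul_of_one_le_of_one_le (one_le_pow₀ hn1') hp1
  calc 8 * (n : ℝ) ^ 3 * (L * ((n + b' ^ n) * n) + 1)
      ≤ 8 * (n : ℝ) ^ 3 * (L * ((2 * (n * b' ^ n)) * n) + n ^ 2 * b' ^ n) := by gcongr
    _ = 8 * (2 * (L : ℝ) + 1) * (n ^ 5 * b' ^ n) := by ring
    _ ≤ b ^ n := h1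
    _ ≤ 1 * (b ^ n + 2) := by linarith
    _ ≤ 2 * (n : ℝ) ^ 2 * (b ^ n + 2) := by
        gcongr
        nlinarith

/-! ### Initial spans and the π-property -/

section InitialSpan

variable {X : Type*} [NormedAddCommGroup X] [NormedSpace ℝ X]

theorem initialSpan_mono (e : ℕ → X) : Monotone (initialSpan e) := fun _ _ h =>
  Submodule.span_mono (Set.image_mono (Set.Iio_subset_Iio h))

instance finiteDimensional_initialSpan (e : ℕ → X) (n : ℕ) :
    FiniteDimensional ℝ (initialSpan e n) :=
  FiniteDimensional.span_of_finite ℝ ((Set.finite_Iio n).image e)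

theorem finrank_initialSpan_le (e : ℕ → X) (n : ℕ) : Module.finrank ℝ (initialSpan e n) ≤ n := by
  classical
  have h : e '' Set.Iio n = ((Finset.range n).image e : Set X) := by simp
  rw [initialSpan, h]
  exact (finrank_span_finset_le_card _).trans (Finset.card_image_le.trans (by simp))

theorem exists_mem_initialSpan (e : ℕ → X) {y : X} (hy : y ∈ Submodule.span ℝ (Set.range e)) :
    ∃ n, y ∈ initialSpan e n := by
  induction hy using Submodule.span_induction with
  | mem x hx =>
    obtain ⟨i, rfl⟩ := hx
    exact ⟨i + 1, Submodule.subset_span ⟨i, by simp, rfl⟩⟩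
  | zero => exact ⟨0, Submodule.zero_mem _⟩
  | add x y _ _ hx hy =>
    obtain ⟨m, hm⟩ := hx
    obtain ⟨n, hn⟩ := hy
    exact ⟨max m n, Submodule.add_mem _ (initialSpan_mono e (le_max_left m n) hm)
      (initialSpan_mono e (le_max_right m n) hn)⟩
  | smul a x _ hx =>
    obtain ⟨m, hm⟩ := hx
    exact ⟨m, Submodule.smul_mem _ a hm⟩

/-- Uniformly bounded projections onto cofinally many initial spans give the π-property. -/
theorem hasPiProperty_of_projections {e : ℕ → X} (he : IsFundamentalSeq e) (σ : ℕ → ℕ)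
    (hσ : ∀ k, k ≤ σ k) {C : ℝ} (hC : 0 ≤ C)
    (hP : ∀ k, ∃ P : X →L[ℝ] initialSpan e (σ k),
      (∀ y : initialSpan e (σ k), P y = y) ∧ ∀ x, ‖P x‖ ≤ C * ‖x‖) :
    HasPiProperty X := by
  choose P hPE hPC using hP
  let S : ℕ → X →L[ℝ] X := fun k => (initialSpan e (σ k)).subtypeL ∘L P k
  have hS : ∀ k x, S k x = P k x := fun k x => rfl
  have hSC : ∀ k x, ‖S k x‖ ≤ C * ‖x‖ := fun k x => hPC k x
  -- `ULift` puts the index set in the universe of `X`.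
  refine ⟨ULift ℕ, inferInstance, inferInstance, inferInstance, fun k => S k.down, C,
    fun k => ?_, fun k => ?_, fun k => ContinuousLinearMap.opNorm_le_bound _ hC (hSC _),
    fun x => ?_⟩
  · ext x
    change S k.down (S k.down x) = S k.down x
    simp only [hS, hPE]
  · refine Submodule.finiteDimensional_of_le (S₂ := initialSpan e (σ k.down)) ?_
    rintro _ ⟨x, rfl⟩
    exact (P k.down x).2
  · rw [Metric.tendsto_nhds]
    intro η hη
    have hx : x ∈ closure (Submodule.span ℝ (Set.range e) : Set X) := by
      rw [← Submodule.topologicalClosure_coe, he]; trivial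
    obtain ⟨y, hy, hxy⟩ := Metric.mem_closure_iff.1 hx (η / (C + 1)) (by positivity)
    obtain ⟨n, hn⟩ := exists_mem_initialSpan e hy
    filter_upwards [eventually_ge_atTop (ULift.up n)] with k hk
    have hk' : n ≤ σ k.down := le_trans hk (hσ _)
    have hyk : S k.down y = y := by
      rw [hS, hPE _ ⟨y, initialSpan_mono e hk' hn⟩]
    rw [dist_eq_norm] at hxy ⊢
    have h1 : S k.down x - x = S k.down (x - y) - (x - y) := by rw [map_sub, hyk]; abel
    rw [h1]
    calc ‖S k.down (x - y) - (x - y)‖ ≤ C * ‖x - y‖ + ‖x - y‖ :=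
          (norm_sub_le _ _).trans (by gcongr; exact hSC _ _)
      _ = (C + 1) * ‖x - y‖ := by ring
      _ < (C + 1) * (η / (C + 1)) := by gcongr
      _ = η := by field_simp

theorem infDist_le_height (e : ℕ → X) {K : Set X} (hK : IsCompact K) (n : ℕ) {x : X}
    (hx : x ∈ K) : Metric.infDist x (initialSpan e n) ≤ height e K n :=
  le_csSup (hK.image (Metric.continuous_infDist_pt _)).bddAbove ⟨x, hx, rfl⟩

theorem height_nonneg (e : ℕ → X) (K : Set X) (n : ℕ) : 0 ≤ height e K n :=
  Real.sSup_nonneg (by rintro _ ⟨x, _, rfl⟩; exact Metric.infDist_nonneg)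

theorem innerRadius_nonneg (e : ℕ → X) (K : Set X) (n : ℕ) : 0 ≤ innerRadius e K n :=
  Real.sSup_nonneg fun _ h => h.1

theorem exists_ball_of_lt_innerRadius (e : ℕ → X) (K : Set X) (n : ℕ) {a : ℝ} (ha : 0 ≤ a)
    (h : a < innerRadius e K n) :
    ∃ r, a < r ∧ ∃ p ∈ initialSpan e n, ∀ x ∈ initialSpan e n, ‖x - p‖ ≤ r → x ∈ K := by
  have hne : {r : ℝ | 0 ≤ r ∧ ∃ x ∈ initialSpan e n, Metric.closedBall x r ∩
      (initialSpan e n : Set X) ⊆ K ∩ (initialSpan e n : Set X)}.Nonempty := by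
    -- `0 ≤ a` excludes the default value `sSup ∅ = 0`.
    by_contra hemp
    rw [innerRadius, Set.not_nonempty_iff_eq_empty.1 hemp, Real.sSup_empty] at h
    exact absurd h ha.not_gt
  obtain ⟨r, ⟨_, p, hp, hsub⟩, har⟩ := exists_lt_of_lt_csSup hne h
  exact ⟨r, har, p, hp, fun x hx hxr => (hsub ⟨mem_closedBall_iff_norm.2 hxr, hx⟩).1⟩

end InitialSpan

theorem mainTheorem1 {X : Type*} [NormedAddCommGroup X] [NormedSpace ℝ X] [CompleteSpace X]
    [TopologicalSpace.SeparableSpace X]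
    (h : ∃ (K : Set X) (R : X → X), IsCompact K ∧ IsSmall K ∧ IsLipschitzRetractionOnto R K) :
    HasPiProperty X := by
  obtain ⟨K, R, hK, ⟨_, ε, hε, hε1, e, he, σ, hσ, hσ1, hsm⟩, ⟨L, hL⟩, hRK, hRid⟩ := h
  obtain ⟨ε', hεε', hε'1⟩ := exists_between hε1
  have hε' : 0 < ε' := hε.trans hεε'
  obtain ⟨k₀, hk₀⟩ := eventually_atTop.1 (eventually_polynomial_mul_pow_le hε hεε' L)
  have hpos : 0 < 1 - ε' := sub_pos.2 hε'1
  refine hasPiProperty_of_projections he (fun k => σ (k + k₀))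
    (fun k => (Nat.le_add_right k k₀).trans (hσ.id_le _)) (C := 2 * (L + 8) / (1 - ε'))
    (by positivity) fun k => ?_
  obtain ⟨h0, hle⟩ := hsm (k + k₀)
  have hn1 := hσ1 (k + k₀)
  have hnum := hk₀ (σ (k + k₀)) ((Nat.le_add_left k₀ k).trans (hσ.id_le _))
  set n := σ (k + k₀)
  have hn1' : (0 : ℝ) < n := by exact_mod_cast hn1
  have hh : 0 < height e K n := (height_nonneg e K n).lt_of_ne' fun h => by simp [h] at h0
  have hr : 0 < innerRadius e K n :=
    (innerRadius_nonneg e K n).lt_of_ne' fun h => by simp [h] at h0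
  -- The supremum need not be attained; halving it turns the factor 4 required below into the 8 of
  -- the growth estimate.
  obtain ⟨r, hrr, p, hp, hball⟩ := exists_ball_of_lt_innerRadius e K n (half_pos hr).le
    (half_lt_self hr)
  refine exists_bounded_projection_of_retraction (initialSpan e n) (finrank_initialSpan_le e n)
    hε' hε'1 R L hL hh ((half_pos hr).trans hrr) (fun x => infDist_le_height e hK n (hRK x)) p hp
    (fun x hx hxr => hRid x (hball x hx hxr)) ?_
  have hB : (0 : ℝ) < 2 * (n : ℝ) ^ 2 * ((1 + 2 / ε) ^ n + 2) := by positivity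
  rw [div_le_div_iff₀ hr hB, one_mul] at hle
  calc 4 * (n : ℝ) ^ 3 * (L * ((n + (1 + 2 / ε') ^ n) * (n * height e K n)) + height e K n)
      = 8 * (n : ℝ) ^ 3 * (L * ((n + (1 + 2 / ε') ^ n) * n) + 1) * height e K n / 2 := by ring
    _ ≤ 2 * (n : ℝ) ^ 2 * ((1 + 2 / ε) ^ n + 2) * height e K n / 2 := by gcongr
    _ ≤ innerRadius e K n / 2 := by linarith
    _ ≤ r := hrr.le
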